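/- Let $D$ be a knot diagram on the sphere with at least one crossing, and let its projection graph be the four-valent plane graph obtained by forgetting the over/under information (vertices are the crossings). Fix a checkerboard coloring of the faces of the projection graph, i.e. a coloring by black and white in which the two faces on the two sides of any edge have different colors. The Tait graph $G$ is the multigraph (loops and parallel edges allowed) whose vertices are the black faces and whose edges are the crossings, the edge of a crossing $c$ joining the faces at the two opposite black corners of $c$; the dual Tait graph $G^*$ is defined in the same way with the white faces. The overlaid Tait graph $\widehat\Gamma$ is the bipartite multigraph whose first vertex set is the set of crossings, whose second vertex set is the set of all faces (the vertices of $G$ and of $G^*$), and whose edges are the half-edges of $G$ and $G^*$, that is, the corners of the diagram, each corner joining its crossing to the face that contains it. Choose two faces $r$ and $s$ that lie on the two sides of some edge of the projection graph (equivalently, that lie on a common square face of $\widehat\Gamma$), named so that $r$ is black. The balanced overlaid Tait graph $\Gamma$ is obtained from $\widehat\Gamma$ by deleting the vertices $r$ and $s$. Then there is a bijection $\Phi$ from the set of perfect matchings of $\Gamma$ onto the set of spanning trees of $G$ rooted at the omitted vertex $r$. More precisely, $\Phi$ can be chosen such that for every perfect matching $M$: 1. a crossing $c$ is an edge of the tree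 $\Phi(M)$ if and only if $M$ matches $c$ with a black face; 2. if $M$ matches $c$ with a black face $v$ through a corner of $c$, then the face $u$ at the opposite corner of $c$ is joined to $r$ by a path in $\Phi(M)$ that does not use the edge $c$; that is, when the edges of $\Phi(M)$ are directed away from the root $r$, the edge $c$ is directed from $u$ to $v$. -/

import Mathlib

open scoped Graph

namespace Graph

variable {α β : Type*}

/-- Two vertices are joined by a walk. -/
def Reachable (G : Graph α β) (u v : α) : Prop := Relation.ReflTransGen G.Adj u v

/-- A multigraph has no cycle: there are no distinct vertices `v 0, …, v n` and distinct edges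
`e 0, …, e n` such that `e i` joins `v i` to `v (i + 1)`, indices taken modulo `n + 1`.
The case `n = 0` excludes loops, the case `n = 1` excludes pairs of parallel edges. -/
def IsAcyclic (G : Graph α β) : Prop :=
  ∀ (n : ℕ) (v : Fin (n + 1) → α) (e : Fin (n + 1) → β),
    Function.Injective v → Function.Injective e → ¬ ∀ i, G.IsLink (e i) (v i) (v (i + 1))

/-- A tree: a nonempty connected multigraph without cycles. -/
structure IsTree (T : Graph α β) : Prop where
  nonempty : V(T).Nonempty
  connected : ∀ u ∈ V(T), ∀ v ∈ V(T), T.Reachable u v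
  acyclic : T.IsAcyclic

/-- A rooted spanning tree of `G`: a subgraph of `G` that has all the vertices of `G` and is a
tree, together with a vertex of `G`, its root. -/
structure RootedSpanningTree (G : Graph α β) where
  tree : Graph α β
  root : α
  spanning : tree.IsSpanningSubgraph G
  isTree : tree.IsTree
  root_mem : root ∈ V(G)

/-- A perfect matching: a set of non-loop edges such that every vertex is an end of exactly one
of them. -/
structure IsPerfectMatching (G : Graph α β) (M : Set β) : Prop where
  subset : M ⊆ E(G)
  not_isLoopAt : ∀ e ∈ M, ∀ v, ¬ G.IsLoopAt e v
  existsUnique : ∀ v ∈ V(G), ∃! e, e ∈ M ∧ G.Inc e v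

end Graph

/-- A four-valent graph with a rotation system, on the finite set `H` of half-edges.
`rot x` is the half-edge that follows `x` counterclockwise around its crossing, and `flip x` is
the other half of the edge that contains `x`. -/
structure FourValentMap (H : Type*) where
  finite : Finite H
  rot : Equiv.Perm H
  flip : Equiv.Perm H
  rot_four : ∀ x, rot (rot (rot (rot x))) = x
  rot_two : ∀ x, rot (rot x) ≠ x
  flip_flip : ∀ x, flip (flip x) = x
  flip_ne : ∀ x, flip x ≠ x

namespace FourValentMap

variable {H : Type*} (P : FourValentMap H)

/-- The vertices of the graph: the cycles of the rotation. -/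
def Crossing : Type _ := Quotient (Equiv.Perm.SameCycle.setoid P.rot)

/-- The edges of the graph: pairs of half-edges. -/
def Edge : Type _ := Quotient (Equiv.Perm.SameCycle.setoid P.flip)

/-- The face permutation: walk along `x` with the face on the left, then continue along the
boundary of this face, that is, leave by the half-edge that precedes `flip x` around the crossing
which has been reached. -/
def facePerm : Equiv.Perm H := P.rot⁻¹ * P.flip

/-- The faces: the cycles of the face permutation. -/
def Face : Type _ := Quotient (Equiv.Perm.SameCycle.setoid P.facePerm)

/-- The crossing at which a half-edge starts. -/
def crossing (x : H) : P.Crossing := Quotient.mk _ x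

/-- The face to the left of a half-edge `x` (directed away from its crossing). It is the face
that contains the corner between `x` and `rot x`. The face to the right of `x` is
`face (flip x)`. -/
def face (x : H) : P.Face := Quotient.mk _ x

end FourValentMap

/-- A knot diagram (with at least one crossing) on the sphere, given combinatorially: its
projection graph, the over/under information, and the conditions that the rotation system is that
of a graph on the sphere (Euler's formula) and that there is a single component. -/
structure KnotDiagram (H : Type*) extends FourValentMap H where
  /-- `isOver x` says that `x` belongs to the over-strand of its crossing. -/
  isOver : H → Prop
  /-- Of the two strands through a crossing, one is over and the other is under. -/
  isOver_rot : ∀ x, isOver (rot x) ↔ ¬ isOver x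
  /-- Passing along edges and straight through crossings leads from any half-edge to any other. -/
  single_component : ∀ x y, ∃ g ∈ Subgroup.closure {rot ^ 2, flip}, g x = y
  /-- Euler's formula for the sphere. -/
  euler : (Nat.card toFourValentMap.Crossing : ℤ) - Nat.card toFourValentMap.Edge
    + Nat.card toFourValentMap.Face = 2

namespace KnotDiagram

variable {H : Type*} (D : KnotDiagram H)

/-- A checkerboard coloring: the faces on the two sides of every edge of the projection graph have
different colors. -/
structure Checkerboard where
  black : D.Face → Prop
  alternate : ∀ x, black (D.face (D.flip x)) ↔ ¬ black (D.face x)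

variable {D}

theorem face_flip_rot (x : H) : D.face (D.flip (D.rot x)) = D.face x :=
  Quotient.sound ⟨1, by simp [FourValentMap.facePerm, D.flip_flip]⟩

theorem Checkerboard.black_rot (C : D.Checkerboard) (x : H) :
    C.black (D.face (D.rot x)) ↔ ¬ C.black (D.face x) := by
  have h := C.alternate (D.rot x)
  rw [face_flip_rot] at h
  tauto

theorem crossing_rot (x : H) : D.crossing (D.rot x) = D.crossing x :=
  Quotient.sound ⟨-1, by simp⟩

theorem eq_of_crossing_eq {x y : H} (h : D.crossing x = D.crossing y) :
    y = x ∨ y = D.rot x ∨ y = D.rot (D.rot x) ∨ y = D.rot (D.rot (D.rot x)) := by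
  obtain ⟨k, hk⟩ : Equiv.Perm.SameCycle D.rot x y := Quotient.exact h
  have h4 : D.rot ^ (4 : ℤ) = 1 := by
    ext z
    exact D.rot_four z
  have hk' : (D.rot ^ (k % 4)) x = y := by
    rw [← hk]
    conv_rhs => rw [← Int.emod_add_mul_ediv k 4, zpow_add, zpow_mul, h4, one_zpow, mul_one]
  have h0 := Int.emod_nonneg k (show (4 : ℤ) ≠ 0 by norm_num)
  have h1 := Int.emod_lt_of_pos k (show (0 : ℤ) < 4 by norm_num)
  generalize k % 4 = m at *
  interval_cases m
  · left; exact hk'.symm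
  · right; left; exact hk'.symm
  · right; right; left; exact hk'.symm
  · right; right; right; exact hk'.symm

theorem Checkerboard.eq_of_crossing_eq (C : D.Checkerboard) {x y : H}
    (h : D.crossing x = D.crossing y) (hx : C.black (D.face x)) (hy : C.black (D.face y)) :
    y = x ∨ y = D.rot (D.rot x) := by
  have h1 := C.black_rot x
  have h2 := C.black_rot (D.rot x)
  have h3 := C.black_rot (D.rot (D.rot x))
  rcases KnotDiagram.eq_of_crossing_eq h with rfl | rfl | rfl | rfl <;> tauto

/-- The Tait graph: its vertices are the black faces and its edges are the crossings. The edge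
of a crossing joins the faces at the two opposite black corners of the crossing. It is a
multigraph, in general with loops and parallel edges. -/
def Checkerboard.taitGraph (C : D.Checkerboard) : Graph D.Face D.Crossing where
  vertexSet := {f | C.black f}
  IsLink c u v := ∃ x, D.crossing x = c ∧ C.black (D.face x) ∧
    u = D.face x ∧ v = D.face (D.rot (D.rot x))
  isLink_symm := by
    intro e _
    refine ⟨?_⟩
    rintro u v ⟨x, rfl, hx, rfl, rfl⟩
    refine ⟨D.rot (D.rot x), by rw [crossing_rot, crossing_rot], ?_, rfl, by rw [D.rot_four]⟩
    rw [C.black_rot, C.black_rot, not_not]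
    exact hx
  eq_or_eq_of_isLink_of_isLink := by
    rintro e u v u' v' ⟨x, rfl, hx, rfl, rfl⟩ ⟨y, hy, hby, rfl, rfl⟩
    rcases C.eq_of_crossing_eq hy.symm hx hby with rfl | rfl
    · exact Or.inl rfl
    · right
      rw [D.rot_four]
  left_mem_of_isLink := by
    rintro e u v ⟨x, rfl, hx, rfl, rfl⟩
    exact hx

variable (D)

/-- The overlaid Tait graph: its vertices are the crossings, which are the intersection points of
the edges of the Tait graph with those of the dual Tait graph, and all faces, which are the
vertices of the Tait graph (black) and of its dual (white). Its edges are the half-edges of both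
Tait graphs, that is, the corners of the diagram: the corner between `x` and `rot x` is an edge
from the crossing of `x` to the face that contains this corner. -/
def overlaidTaitGraph : Graph (D.Crossing ⊕ D.Face) H where
  vertexSet := Set.univ
  IsLink x a b := (a = Sum.inl (D.crossing x) ∧ b = Sum.inr (D.face x)) ∨
    (a = Sum.inr (D.face x) ∧ b = Sum.inl (D.crossing x))
  isLink_symm := by
    intro e _
    refine ⟨?_⟩
    intro a b h
    tauto
  eq_or_eq_of_isLink_of_isLink := by
    rintro e a b a' b' (⟨rfl, rfl⟩ | ⟨rfl, rfl⟩) (⟨rfl, rfl⟩ | ⟨rfl, rfl⟩) <;> simp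
  left_mem_of_isLink := by simp

/-- The balanced overlaid Tait graph: delete the vertices of two faces `r` and `s`. -/
def balancedOverlaidTaitGraph (r s : D.Face) : Graph (D.Crossing ⊕ D.Face) H :=
  D.overlaidTaitGraph.deleteVerts {Sum.inr r, Sum.inr s}

/-- The faces `r` and `s` lie on the two sides of some edge of the projection graph;
equivalently, they are the two face vertices of a square face of the overlaid Tait graph. -/
def OnSameSquare (r s : D.Face) : Prop := ∃ x, D.face x = r ∧ D.face (D.flip x) = s

end KnotDiagram

/-!
In a perfect matching every black face other than `r` is matched with a crossing, an edge of the
Tait graph, which is directed towards this face. So the crossings matched with black faces form a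
subgraph of the Tait graph whose edges have distinct heads, none of them `r`, and likewise those
matched with white faces in the dual Tait graph, with `s` in place of `r`. In such a subgraph the
part reachable from the root is a tree directed away from the root. Walking around the boundary of
this tree stays in the dual subgraph, hence the parts reachable from `r` and from `s` border only on
each other. As the diagram is connected, they contain all faces, so the black subgraph is a spanning
tree. Conversely, by Euler's formula the complement of a spanning tree has the right number of edges
to be a spanning tree of the dual Tait graph, and the orientations of the two trees away from `r`
and `s` recover the matching.
-/

namespace Multigraph

variable {α β : Type*} {G : Graph α β} {c e : β} {r u v w : α}

theorem reachable_symm (h : G.Reachable u v) : G.Reachable v u :=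
  symm_of (Relation.ReflTransGen G.Adj) h

theorem reachable_fromRel (h : G.Reachable u v) : (SimpleGraph.fromRel G.Adj).Reachable u v := by
  induction h with
  | refl => exact .refl _
  | @tail v w _ h ih =>
    obtain rfl | hvw := eq_or_ne v w
    · exact ih
    · exact ih.trans (SimpleGraph.Adj.reachable ⟨hvw, .inl h⟩)

theorem exists_isLink_chain_of_reachable (h : G.Reachable u v) :
    ∃ (n : ℕ) (p : Fin (n + 1) → α) (e : Fin n → β), p.Injective ∧ p 0 = u ∧ p (Fin.last n) = v ∧
      ∀ i, G.IsLink (e i) (p i.castSucc) (p i.succ) := by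
  obtain ⟨p, hp⟩ := (reachable_fromRel h).exists_isPath
  have adj (i : Fin p.length) : G.Adj (p.getVert i) (p.getVert (i + 1)) :=
    (p.adj_getVert_succ i.2).2.elim id .symm
  choose e he using adj
  refine ⟨p.length, fun i => p.getVert i, e, fun i j hij => Fin.ext ?_, p.getVert_zero,
    p.getVert_length, he⟩
  exact hp.getVert_injOn (Nat.le_of_lt_succ i.2) (Nat.le_of_lt_succ j.2) hij

theorem injective_of_isLink_chain {n : ℕ} {p : Fin (n + 1) → α} {e : Fin n → β}
    (hp : p.Injective) (he : ∀ i, G.IsLink (e i) (p i.castSucc) (p i.succ)) : e.Injective := by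
  intro i j hij
  rcases (he i).eq_and_eq_or_eq_and_eq (hij ▸ he j) with ⟨h, -⟩ | ⟨h₁, h₂⟩
  · exact Fin.castSucc_injective n (hp h)
  · have h₁' := congrArg Fin.val (hp h₁)
    have h₂' := congrArg Fin.val (hp h₂)
    simp only [Fin.val_castSucc, Fin.val_succ] at h₁' h₂'
    lia

theorem not_reachable_deleteEdges (hG : G.IsAcyclic) (h : G.IsLink c u v) :
    ¬ (G.deleteEdges {c}).Reachable u v := by
  intro huv
  obtain ⟨n, p, e, hp, rfl, rfl, he⟩ := exists_isLink_chain_of_reachable huv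
  have hec : c ∉ Set.range e := by
    rintro ⟨i, hi⟩
    exact (Graph.deleteEdges_inc.1 (he i).inc_left).2 hi
  refine hG n p (Fin.snoc e c) hp
    (Fin.snoc_injective_of_injective (injective_of_isLink_chain hp he) hec) fun i => ?_
  induction i using Fin.lastCases with
  | last => simpa using h.symm
  | cast i => simpa [Fin.coeSucc_eq_succ] using (he i).mono Graph.deleteEdges_le

/-- The number of edges of a shortest walk from `u` to `v`, computed in the underlying simple graph;
it has the junk value `0` when there is no such walk. -/
noncomputable def dist (G : Graph α β) (u v : α) : ℕ := (SimpleGraph.fromRel G.Adj).dist u v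

theorem exists_isLink_dist_eq_add_one (h : G.Reachable r v) (hv : v ≠ r) :
    ∃ e u, G.IsLink e u v ∧ G.Reachable r u ∧ dist G r v = dist G r u + 1 := by
  obtain ⟨p, hp⟩ := (reachable_fromRel (reachable_symm h)).exists_walk_length_eq_dist
  cases p with
  | nil => exact absurd rfl hv
  | @cons _ u _ hvu p =>
    obtain ⟨e, he⟩ : G.Adj u v := hvu.2.elim .symm id
    have hle := SimpleGraph.dist_le p
    have htri := hvu.reachable.dist_triangle_left r
    rw [SimpleGraph.Walk.length_cons] at hp
    rw [SimpleGraph.dist_eq_one_iff_adj.2 hvu] at htri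
    refine ⟨e, u, he, h.tail ⟨e, he.symm⟩, ?_⟩
    rw [dist, dist, SimpleGraph.dist_comm, SimpleGraph.dist_comm (u := r)]
    lia

theorem reachable_deleteEdges_of_dist_le (h : G.Reachable r w) (he : G.Inc e v) (hwv : w ≠ v)
    (hd : dist G r w ≤ dist G r v) : (G.deleteEdges {e}).Reachable r w := by
  induction hn : dist G r w using Nat.strong_induction_on generalizing w with
  | _ n ih =>
    obtain rfl | hwr := eq_or_ne w r
    · exact .refl
    obtain ⟨f, u, hf, hu, hdu⟩ := exists_isLink_dist_eq_add_one h hwr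
    have huv : u ≠ v := by
      rintro rfl
      lia
    have hfe : f ≠ e := by
      rintro rfl
      exact (he.eq_or_eq_of_isLink hf).elim huv.symm hwv.symm
    exact (ih _ (by lia) hu huv (by lia) rfl).tail ⟨f, (Graph.deleteEdges_isLink ..).mpr ⟨hf, hfe⟩⟩

/-- An orientation of the edges of `G`, the edge `e` being directed towards its end `head e`, in
which at most one edge enters each vertex and none enters `r`. The values of `head` off `E(G)` are
irrelevant. -/
structure IsBranching (G : Graph α β) (r : α) (head : β → α) : Prop where
  inc : ∀ e ∈ E(G), G.Inc e (head e)
  ne_root : ∀ e ∈ E(G), head e ≠ r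
  injOn : Set.InjOn head E(G)

namespace IsBranching

variable {head : β → α}

theorem eq_or_eq (hG : IsBranching G r head) (h : G.IsLink e u v) : head e = u ∨ head e = v :=
  (hG.inc e h.edge_mem).eq_or_eq_of_isLink h

theorem dist_head (hG : IsBranching G r head) (hv : G.Reachable r (head e))
    (h : G.IsLink e u (head e)) : dist G r (head e) = dist G r u + 1 := by
  induction hn : dist G r (head e) using Nat.strong_induction_on generalizing e u with
  | _ n ih =>
    obtain ⟨f, w, hf, hw, hd⟩ := exists_isLink_dist_eq_add_one hv (hG.ne_root e h.edge_mem)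
    rcases hG.eq_or_eq hf with rfl | hfe
    · have := ih _ (by lia) hw hf.symm rfl
      lia
    · obtain rfl := hG.injOn hf.edge_mem h.edge_mem hfe
      rw [h.left_unique hf]
      lia

theorem reachable_tail (hG : IsBranching G r head) (hv : G.Reachable r (head e))
    (h : G.IsLink e u (head e)) : (G.deleteEdges {e}).Reachable r u := by
  have hd := hG.dist_head hv h
  refine reachable_deleteEdges_of_dist_le (hv.tail h.symm.adj) h.inc_right ?_ (by lia)
  rintro rfl
  lia

theorem isAcyclic (hG : IsBranching G r head) (hr : ∀ v ∈ V(G), G.Reachable r v) :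
    G.IsAcyclic := by
  intro n v e _ he hl
  have hd {i} {u} (h : G.IsLink (e i) u (head (e i))) : dist G r (head (e i)) = dist G r u + 1 :=
    hG.dist_head (hr _ h.right_mem) h
  -- Both edges of the cycle at a vertex farthest from the root would have to enter this vertex.
  obtain ⟨i, hi⟩ := Finite.exists_max fun i => dist G r (v i)
  have hnext : head (e i) = v i := by
    refine (hG.eq_or_eq (hl i)).resolve_right fun h => ?_
    have := hd (h ▸ hl i)
    have := hi (i + 1)
    rw [h] at *
    lia
  have hprev : head (e (i - 1)) = v i := by
    have hl' := hl (i - 1)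
    rw [sub_add_cancel] at hl'
    refine (hG.eq_or_eq hl').resolve_left fun h => ?_
    have := hd (h ▸ hl'.symm)
    have := hi (i - 1)
    rw [h] at *
    lia
  have heq : i - 1 = i := he (hG.injOn (hl _).edge_mem (hl _).edge_mem (hprev.trans hnext.symm))
  have hloop := hl (i - 1)
  rw [sub_add_cancel, heq, ← hnext] at hloop
  have := hd hloop
  lia

theorem isTree (hG : IsBranching G r head) (hrG : r ∈ V(G)) (hr : ∀ v ∈ V(G), G.Reachable r v) :
    G.IsTree where
  nonempty := ⟨r, hrG⟩
  connected u hu v hv := (reachable_symm (hr u hu)).trans (hr v hv)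
  acyclic := hG.isAcyclic hr

theorem bijOn (hG : IsBranching G r head) (hr : ∀ v ∈ V(G), G.Reachable r v) :
    Set.BijOn head E(G) (V(G) \ {r}) := by
  refine ⟨fun e he => ⟨(hG.inc e he).vertex_mem, hG.ne_root e he⟩, hG.injOn, ?_⟩
  rintro v ⟨hv, hvr⟩
  obtain ⟨e, u, he, hu, hd⟩ := exists_isLink_dist_eq_add_one (hr v hv) hvr
  refine ⟨e, he.edge_mem, (hG.eq_or_eq he).resolve_left ?_⟩
  rintro rfl
  have := hG.dist_head hu he.symm
  lia

theorem ncard_edgeSet_add_one [Finite α] (hG : IsBranching G r head) (hrG : r ∈ V(G))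
    (hr : ∀ v ∈ V(G), G.Reachable r v) : E(G).ncard + 1 = V(G).ncard := by
  rw [← Set.ncard_sdiff_singleton_add_one hrG, ← (hG.bijOn hr).image_eq, hG.injOn.ncard_image]

end IsBranching

/-- A choice, for every vertex `v ≠ r`, of an edge that leads from `v` to a vertex closer to `r`. -/
def IsParentEdgeMap (G : Graph α β) (r : α) (p : α → β) : Prop :=
  ∀ v ∈ V(G), v ≠ r → ∃ u, G.IsLink (p v) u v ∧ dist G r v = dist G r u + 1

theorem exists_isParentEdgeMap [Nonempty β] (hr : ∀ v ∈ V(G), G.Reachable r v) :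
    ∃ p, IsParentEdgeMap G r p := by
  choose! p u hp _ hd using fun v (hv : v ∈ V(G)) => exists_isLink_dist_eq_add_one (hr v hv)
  exact ⟨p, fun v hv hvr => ⟨u v, hp v hv hvr, hd v hv hvr⟩⟩

namespace IsParentEdgeMap

variable {p : α → β}

theorem mapsTo (hp : IsParentEdgeMap G r p) : Set.MapsTo p (V(G) \ {r}) E(G) := by
  rintro v ⟨hv, hvr⟩
  obtain ⟨u, hl, -⟩ := hp v hv hvr
  exact hl.edge_mem

theorem injOn (hp : IsParentEdgeMap G r p) : Set.InjOn p (V(G) \ {r}) := by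
  rintro v ⟨hv, hvr⟩ w ⟨hw, hwr⟩ hvw
  obtain ⟨u, hl, hd⟩ := hp v hv hvr
  obtain ⟨t, hl', hd'⟩ := hp w hw hwr
  rcases hl.eq_and_eq_or_eq_and_eq (hvw ▸ hl') with ⟨-, h⟩ | ⟨rfl, rfl⟩
  · exact h
  · lia

theorem exists_isBranching (hp : IsParentEdgeMap G r p) (hsurj : Set.SurjOn p (V(G) \ {r}) E(G)) :
    ∃ head, IsBranching G r head := by
  have : Nonempty α := ⟨r⟩
  have hinv : Set.LeftInvOn p (Function.invFunOn p (V(G) \ {r})) E(G) := hsurj.rightInvOn_invFunOn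
  refine ⟨Function.invFunOn p (V(G) \ {r}), fun e he => ?_, fun e he => ?_, hinv.injOn⟩
  · obtain ⟨u, hl, -⟩ := hp _ (hsurj.mapsTo_invFunOn he).1 (hsurj.mapsTo_invFunOn he).2
    rw [hinv he] at hl
    exact hl.inc_right
  · exact (hsurj.mapsTo_invFunOn he).2

theorem surjOn_of_isAcyclic (hp : IsParentEdgeMap G r p) (hr : ∀ v ∈ V(G), G.Reachable r v)
    (hG : G.IsAcyclic) : Set.SurjOn p (V(G) \ {r}) E(G) := by
  intro e he
  obtain ⟨u, v, hl⟩ := G.exists_isLink_of_mem_edgeSet he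
  wlog hd : dist G r u ≤ dist G r v generalizing u v
  · exact this v u hl.symm (by lia)
  -- The tail `u` is reached without `e`, so `e` must be the edge through which `v` is reached.
  have hbridge := not_reachable_deleteEdges hG hl
  have huv : u ≠ v := fun h => hbridge (h ▸ .refl)
  have hu := reachable_deleteEdges_of_dist_le (hr u hl.left_mem) hl.inc_right huv hd
  have hvr : v ≠ r := by
    rintro rfl
    exact hbridge (reachable_symm hu)
  obtain ⟨w, hw, hdw⟩ := hp v hl.right_mem hvr
  refine ⟨v, ⟨hl.right_mem, hvr⟩, by_contra fun hne => hbridge ?_⟩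
  have hwv : w ≠ v := by
    rintro rfl
    lia
  have hw' := reachable_deleteEdges_of_dist_le (hr w hw.left_mem) hl.inc_right hwv (by lia)
  exact (reachable_symm hu).trans (hw'.tail ⟨p v, (Graph.deleteEdges_isLink ..).mpr ⟨hw, hne⟩⟩)

theorem surjOn_of_ncard_edgeSet [Finite β] (hp : IsParentEdgeMap G r p) (hrG : r ∈ V(G))
    (hcard : E(G).ncard + 1 = V(G).ncard) : Set.SurjOn p (V(G) \ {r}) E(G) := by
  refine (Set.eq_of_subset_of_ncard_le hp.mapsTo.image_subset ?_).superset
  rw [hp.injOn.ncard_image, Set.ncard_sdiff_singleton_of_mem hrG]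
  lia

end IsParentEdgeMap

theorem exists_isBranching_of_isTree (hG : G.IsTree) (hrG : r ∈ V(G)) :
    ∃ head, IsBranching G r head := by
  obtain _ | _ := isEmpty_or_nonempty β
  · exact ⟨isEmptyElim, isEmptyElim, isEmptyElim, fun e => isEmptyElim e⟩
  have hr := hG.connected r hrG
  obtain ⟨p, hp⟩ := exists_isParentEdgeMap hr
  exact hp.exists_isBranching (hp.surjOn_of_isAcyclic hr hG.acyclic)

theorem exists_isBranching_of_ncard_edgeSet [Finite β] (hrG : r ∈ V(G))
    (hr : ∀ v ∈ V(G), G.Reachable r v) (hcard : E(G).ncard + 1 = V(G).ncard) :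
    ∃ head, IsBranching G r head := by
  obtain _ | _ := isEmpty_or_nonempty β
  · exact ⟨isEmptyElim, isEmptyElim, isEmptyElim, fun e => isEmptyElim e⟩
  obtain ⟨p, hp⟩ := exists_isParentEdgeMap hr
  exact hp.exists_isBranching (hp.surjOn_of_ncard_edgeSet hrG hcard)

theorem eq_restrict_edgeSet {T : Graph α β} (h : T.IsSpanningSubgraph G) :
    T = G.restrict E(T) := by
  refine Graph.Compatible.ext h.vertexSet_eq ?_ (.of_le_le h.le Graph.restrict_le)
  simpa using Graph.IsSubgraph.edgeSet_mono h.le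

theorem rootedSpanningTree_ext {T T' : G.RootedSpanningTree} (h : E(T.tree) = E(T'.tree))
    (hr : T.root = T'.root) : T = T' := by
  have htree : T.tree = T'.tree := by
    rw [eq_restrict_edgeSet T.spanning, h, ← eq_restrict_edgeSet T'.spanning]
  cases T
  cases T'
  simp_all

end Multigraph

theorem card_eq_card_quotient_mul {α : Type*} [Finite α] (S : Setoid α) {n : ℕ}
    (hS : ∀ a, {b | S b a}.ncard = n) : Nat.card α = Nat.card (Quotient S) * n := by
  have := Fintype.ofFinite (Quotient S)
  have hfiber (q : Quotient S) : Nat.card {b // Quotient.mk S b = q} = n := by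
    induction q using Quotient.inductionOn with
    | _ a => simpa only [Quotient.eq] using! hS a
  rw [← Nat.card_congr (Equiv.sigmaFiberEquiv (Quotient.mk S)), Nat.card_sigma]
  simp [hfiber]

namespace KnotDiagram

variable {H : Type*} {D : KnotDiagram H} {r s : D.Face}

theorem finite_face (D : KnotDiagram H) : Finite D.Face :=
  have := D.finite
  inferInstanceAs (Finite (Quotient _))

theorem finite_crossing (D : KnotDiagram H) : Finite D.Crossing :=
  have := D.finite
  inferInstanceAs (Finite (Quotient _))

theorem face_rot_rot_rot (x : H) : D.face (D.rot (D.rot (D.rot x))) = D.face (D.flip x) := by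
  rw [← face_flip_rot, D.rot_four]

theorem crossing_rot_rot (x : H) : D.crossing (D.rot (D.rot x)) = D.crossing x := by
  rw [crossing_rot, crossing_rot]

theorem ncard_sameCycle_rot (x : H) : {y | D.rot.SameCycle y x}.ncard = 4 := by
  have hclass : {y | D.rot.SameCycle y x} =
      {x, D.rot x, D.rot (D.rot x), D.rot (D.rot (D.rot x))} := by
    ext y
    refine ⟨fun h => eq_of_crossing_eq (Quotient.sound h.symm), ?_⟩
    rintro (rfl | rfl | rfl | rfl) <;> simp [Equiv.Perm.SameCycle.refl]
  have hrot (y : H) : y ≠ D.rot y := fun h => D.rot_two y (by rw [← h, ← h])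
  have hrot₃ : x ≠ D.rot (D.rot (D.rot x)) := fun h => hrot x <| by
    conv_rhs => rw [h, D.rot_four]
  rw [hclass, Set.ncard_insert_of_notMem, Set.ncard_insert_of_notMem, Set.ncard_pair] <;>
    simp [hrot, (D.rot_two _).symm, hrot₃]

theorem ncard_sameCycle_flip (x : H) : {y | D.flip.SameCycle y x}.ncard = 2 := by
  have hflip : D.flip ^ (2 : ℤ) = 1 := Equiv.ext D.flip_flip
  have hclass : {y | D.flip.SameCycle y x} = {x, D.flip x} := by
    ext y
    constructor
    · intro h
      obtain ⟨k, rfl⟩ := h.symm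
      obtain ⟨k, rfl | rfl⟩ := Int.even_or_odd' k <;> simp [zpow_add, zpow_mul, hflip]
    · rintro (rfl | rfl) <;> simp [Equiv.Perm.SameCycle.refl]
  rw [hclass, Set.ncard_pair (D.flip_ne x).symm]

theorem card_face (D : KnotDiagram H) : Nat.card D.Face = Nat.card D.Crossing + 2 := by
  have := D.finite
  have hcrossing : Nat.card H = Nat.card D.Crossing * 4 :=
    card_eq_card_quotient_mul _ ncard_sameCycle_rot
  have hedge : Nat.card H = Nat.card D.Edge * 2 := card_eq_card_quotient_mul _ ncard_sameCycle_flip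
  have heuler := D.euler
  lia

theorem facePerm_inv_apply (x : H) : D.facePerm⁻¹ x = D.flip (D.rot x) := by
  rw [Equiv.Perm.inv_eq_iff_eq]
  simp [FourValentMap.facePerm, D.flip_flip]

theorem iff_of_face_eq {Q : H → Prop} {x y : H}
    (hQ : ∀ z, D.face z = D.face x → z ≠ x → (Q z ↔ Q (D.flip (D.rot z))))
    (hy : D.face y = D.face x) : Q y ↔ Q x := by
  have := D.finite
  have h : Equiv.Perm.SameCycle D.facePerm x y := Quotient.exact hy.symm
  obtain ⟨k, -, rfl⟩ := h.exists_pow_eq'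
  clear h hy
  induction k with
  | zero => rfl
  | succ k ih =>
    by_cases hx : (D.facePerm ^ (k + 1)) x = x
    · rw [hx]
    · rw [hQ _ (Quotient.sound (Equiv.Perm.SameCycle.symm ⟨k + 1, by simp [← zpow_natCast]⟩)) hx,
        ← facePerm_inv_apply, pow_succ', ← Equiv.Perm.mul_apply, inv_mul_cancel_left]
      exact ih

theorem reachable_face_flip_of_face_eq {β : Type*} {G : Graph D.Face β} {E : Set H} {f : D.Face}
    {x y : H} (hE : ∀ z ∈ E, D.face z = f → ∀ w ∈ E, D.face w = f → z = w)
    (hG : ∀ z ∉ E, D.face z = f → G.Reachable (D.face (D.flip z)) (D.face (D.rot z)))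
    (hx : D.face x = f) (hy : D.face y = f) :
    G.Reachable (D.face (D.flip x)) (D.face (D.flip y)) := by
  obtain ⟨x₀, hx₀, hunique⟩ : ∃ x₀, D.face x₀ = f ∧ ∀ z ∈ E, D.face z = f → z = x₀ := by
    by_cases h : ∃ x₀ ∈ E, D.face x₀ = f
    · obtain ⟨x₀, hx₀E, hx₀⟩ := h
      exact ⟨x₀, hx₀, fun z hz hzf => hE z hz hzf x₀ hx₀E hx₀⟩
    · exact ⟨x, hx, fun z hz hzf => absurd ⟨z, hz, hzf⟩ h⟩
  have hwalk {z : H} (hz : D.face z = f) :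
      G.Reachable (D.face (D.flip x₀)) (D.face (D.flip z)) := by
    refine (iff_of_face_eq (Q := fun z => G.Reachable (D.face (D.flip x₀)) (D.face (D.flip z)))
      (fun z hz hne => ?_) (hz.trans hx₀.symm)).2 .refl
    have h := hG z (fun hzE => hne (hunique z hzE (hz.trans hx₀))) (hz.trans hx₀)
    rw [D.flip_flip]
    exact ⟨fun h' => h'.trans h, fun h' => h'.trans (Multigraph.reachable_symm h)⟩
  exact (Multigraph.reachable_symm (hwalk hx)).trans (hwalk hy)

theorem forall_face_of_flip {Z : D.Face → Prop}
    (hZ : ∀ x, Z (D.face x) → Z (D.face (D.flip x))) {f : D.Face} (hf : Z f) (g : D.Face) :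
    Z g := by
  have hrot (x : H) (h : Z (D.face x)) : Z (D.face (D.rot x)) := by
    rw [← face_flip_rot] at h
    simpa only [D.flip_flip] using hZ _ h
  have hrot₂ (x : H) : Z (D.face x) ↔ Z (D.face ((D.rot ^ 2) x)) :=
    ⟨fun h => hrot _ (hrot _ h), fun h => D.rot_four x ▸ hrot _ (hrot _ h)⟩
  have hflip (x : H) : Z (D.face x) ↔ Z (D.face (D.flip x)) :=
    ⟨hZ x, fun h => D.flip_flip x ▸ hZ _ h⟩
  obtain ⟨x, rfl⟩ : ∃ x, D.face x = f := Quotient.exists_rep f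
  obtain ⟨y, rfl⟩ : ∃ y, D.face y = g := Quotient.exists_rep g
  obtain ⟨σ, hσ, rfl⟩ := D.single_component x y
  suffices ∀ z, Z (D.face z) ↔ Z (D.face (σ z)) from (this x).1 hf
  clear hf
  induction hσ using Subgroup.closure_induction with
  | mem σ h =>
    rcases h with rfl | rfl
    exacts [hrot₂, hflip]
  | one => exact fun _ => Iff.rfl
  | mul σ τ _ _ hσ hτ => exact fun z => (hτ z).trans (hσ _)
  | inv σ _ hσ => exact fun z => by simpa using (hσ (σ⁻¹ z)).symm

theorem OnSameSquare.symm (h : D.OnSameSquare r s) : D.OnSameSquare s r := by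
  obtain ⟨x, rfl, rfl⟩ := h
  exact ⟨D.flip x, rfl, by rw [D.flip_flip]⟩

namespace Checkerboard

theorem black_rot_rot (C : D.Checkerboard) (x : H) :
    C.black (D.face (D.rot (D.rot x))) ↔ C.black (D.face x) := by
  rw [C.black_rot, C.black_rot, not_not]

theorem not_black_of_onSameSquare (C : D.Checkerboard) (h : D.OnSameSquare r s)
    (hr : C.black r) : ¬ C.black s := by
  obtain ⟨x, rfl, rfl⟩ := h
  rwa [C.alternate, not_not]

theorem exists_black_corner (C : D.Checkerboard) (c : D.Crossing) :
    ∃ x, D.crossing x = c ∧ C.black (D.face x) := by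
  obtain ⟨x, rfl⟩ : ∃ x, D.crossing x = c := Quotient.exists_rep c
  by_cases hx : C.black (D.face x)
  · exact ⟨x, rfl, hx⟩
  · exact ⟨D.rot x, crossing_rot x, (C.black_rot x).2 hx⟩

/-- The checkerboard coloring with the two colors interchanged. Its Tait graph is the dual Tait
graph. -/
def swap (C : D.Checkerboard) : D.Checkerboard where
  black f := ¬ C.black f
  alternate x := not_congr (C.alternate x)

@[simp]
theorem swap_swap (C : D.Checkerboard) : C.swap.swap = C := by
  cases C
  simp only [swap, not_not]

/-- The subgraph of the Tait graph with all vertices and with edge set `K`. For a set of edges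
`K` of the Tait graph, the dual edges of the other edges form `C.swap.subgraph Kᶜ`. -/
def subgraph (C : D.Checkerboard) (K : Set D.Crossing) : Graph D.Face D.Crossing :=
  C.taitGraph.restrict K

variable {C : D.Checkerboard} {K : Set D.Crossing} {x y : H} {f : D.Face}

theorem edgeSet_taitGraph : E(C.taitGraph) = Set.univ := by
  refine Set.eq_univ_of_forall fun c => ?_
  obtain ⟨x, hx, hb⟩ := C.exists_black_corner c
  exact Graph.IsLink.edge_mem (G := C.taitGraph) ⟨x, hx, hb, rfl, rfl⟩

@[simp]
theorem edgeSet_subgraph : E(C.subgraph K) = K := by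
  simp [subgraph, edgeSet_taitGraph]

theorem isLink_subgraph (hx : C.black (D.face x)) (hxK : D.crossing x ∈ K) :
    (C.subgraph K).IsLink (D.crossing x) (D.face x) (D.face (D.rot (D.rot x))) := by
  rw [subgraph, Graph.restrict_isLink]
  exact ⟨hxK, x, rfl, hx, rfl, rfl⟩

theorem black_of_reachable (hr : C.black r) (h : (C.subgraph K).Reachable r f) : C.black f := by
  cases h with
  | refl => exact hr
  | tail _ h => exact h.right_mem

/-- The black corners through which the edges of `K` enter their heads. -/
def headCorners (C : D.Checkerboard) (K : Set D.Crossing) (head : D.Crossing → D.Face) : Set H :=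
  {x | C.black (D.face x) ∧ D.crossing x ∈ K ∧ head (D.crossing x) = D.face x}

section Branching

open Multigraph

variable {head : D.Crossing → D.Face}

theorem eq_of_mem_headCorners (hG : IsBranching (C.subgraph K) r head)
    (hr : (C.subgraph K).Reachable r (D.face x)) (hx : x ∈ C.headCorners K head)
    (hy : y ∈ C.headCorners K head) (hxy : D.crossing x = D.crossing y) : x = y := by
  obtain ⟨hxb, hxK, hxh⟩ := hx
  rcases C.eq_of_crossing_eq hxy hxb hy.1 with rfl | rfl
  · rfl
  · have hface : D.face x = D.face (D.rot (D.rot x)) := by rw [← hxh, hxy, hy.2.2]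
    have hloop := hG.dist_head (hxh ▸ hr) (u := D.face x) (e := D.crossing x) <| by
      rw [hxh]
      nth_rw 2 [hface]
      exact isLink_subgraph hxb hxK
    rw [hxh] at hloop
    lia

theorem eq_of_mem_headCorners_of_face_eq (hG : IsBranching (C.subgraph K) r head)
    (hr : (C.subgraph K).Reachable r (D.face x)) (hx : x ∈ C.headCorners K head)
    (hy : y ∈ C.headCorners K head) (hxy : D.face x = D.face y) : x = y := by
  refine eq_of_mem_headCorners hG hr hx hy (hG.injOn ?_ ?_ ?_)
  · simpa using hx.2.1
  · simpa using hy.2.1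
  · rw [hx.2.2, hy.2.2, hxy]

theorem reachable_face_flip_face_rot (hx : C.black (D.face x)) (hxK : D.crossing x ∉ K) :
    (C.swap.subgraph Kᶜ).Reachable (D.face (D.flip x)) (D.face (D.rot x)) := by
  have h := isLink_subgraph (C := C.swap) (K := Kᶜ) (x := D.rot x) (by simpa [swap, C.black_rot])
    (by rwa [crossing_rot])
  rw [face_rot_rot_rot] at h
  exact .single h.symm.adj

/-- One walks around the face from corner to corner without crossing the edge of `K` that enters it;
an edge of `K` that leaves it is avoided by going around the whole branch behind this edge. -/
theorem reachable_of_face_eq (hG : IsBranching (C.subgraph K) r head)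
    (hx : C.black (D.face x)) (hr : (C.subgraph K).Reachable r (D.face x))
    (hxy : D.face y = D.face x) :
    (C.swap.subgraph Kᶜ).Reachable (D.face (D.flip x)) (D.face (D.flip y)) := by
  have := D.finite_face
  obtain ⟨n, hn⟩ := (Set.finite_range (Multigraph.dist (C.subgraph K) r)).bddAbove
  replace hn (f) : Multigraph.dist (C.subgraph K) r f ≤ n := hn (Set.mem_range_self f)
  induction hm : n - Multigraph.dist (C.subgraph K) r (D.face x) using Nat.strong_induction_on
    generalizing x y with
  | _ m ih =>
  have step (z : H) (hzh : z ∉ C.headCorners K head) (hz : D.face z = D.face x) :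
      (C.swap.subgraph Kᶜ).Reachable (D.face (D.flip z)) (D.face (D.rot z)) := by
    rw [← hz] at hx hr hm
    by_cases hzK : D.crossing z ∈ K
    · have hl := isLink_subgraph hx hzK
      have hhead : head (D.crossing z) = D.face (D.rot (D.rot z)) :=
        (hG.eq_or_eq hl).resolve_left fun h => hzh ⟨hx, hzK, h⟩
      have hd := hG.dist_head (hhead ▸ hr.tail hl.adj) (hhead ▸ hl)
      rw [hhead] at hd
      have := hn (D.face (D.rot (D.rot z)))
      have h := ih _ (by lia) ((C.black_rot_rot z).2 hx) (hr.tail hl.adj)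
        (face_flip_rot (D.rot (D.rot z))) rfl
      rw [D.flip_flip, face_rot_rot_rot, ← face_rot_rot_rot, D.rot_four] at h
      exact reachable_symm h
    · exact reachable_face_flip_face_rot hx hzK
  exact reachable_face_flip_of_face_eq (fun z hz hzx w hw hwx =>
    eq_of_mem_headCorners_of_face_eq hG (hzx ▸ hr) hz hw (hzx.trans hwx.symm)) step rfl hxy

theorem reachable_face_flip (hG : IsBranching (C.subgraph K) r head) (hrs : D.OnSameSquare r s)
    (hr : C.black r) (hx : (C.subgraph K).Reachable r (D.face x)) :
    (C.swap.subgraph Kᶜ).Reachable s (D.face (D.flip x)) := by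
  obtain ⟨x₀, rfl, rfl⟩ := hrs
  obtain ⟨f, hf⟩ : ∃ f, f = D.face x := ⟨_, rfl⟩
  rw [← hf] at hx
  induction hx generalizing x with
  | refl => exact reachable_of_face_eq hG hr .refl hf.symm
  | tail hg hadj ih =>
    obtain ⟨c, hl⟩ := hadj
    obtain ⟨hcK, y, rfl, hyb, rfl, rfl⟩ := (Graph.restrict_isLink ..).mp hl
    have h := ih (face_flip_rot y).symm
    have h' := reachable_of_face_eq hG ((C.black_rot_rot y).2 hyb) (hg.tail ⟨_, hl⟩)
      (y := x) (x := D.rot (D.rot y)) hf.symm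
    rw [D.flip_flip, ← face_flip_rot (D.rot y)] at h
    exact h.trans h'

end Branching

end Checkerboard

/-- A Kauffman state with the omitted faces `r` and `s`: a set of corners, the state markers, with
exactly one corner at every crossing, exactly one in every face other than `r` and `s`, and none in
`r` and `s`. -/
structure IsKauffmanState (D : KnotDiagram H) (r s : D.Face) (M : Set H) : Prop where
  ne : ∀ x ∈ M, D.face x ≠ r ∧ D.face x ≠ s
  existsUnique_crossing : ∀ c, ∃! x, x ∈ M ∧ D.crossing x = c
  existsUnique_face : ∀ f, f ≠ r → f ≠ s → ∃! x, x ∈ M ∧ D.face x = f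

variable {M M' : Set H}

theorem balancedOverlaidTaitGraph_isLink {x : H} {a b : D.Crossing ⊕ D.Face} :
    (D.balancedOverlaidTaitGraph r s).IsLink x a b ↔ (D.face x ≠ r ∧ D.face x ≠ s) ∧
      ((a = Sum.inl (D.crossing x) ∧ b = Sum.inr (D.face x)) ∨
        (a = Sum.inr (D.face x) ∧ b = Sum.inl (D.crossing x))) := by
  simp only [balancedOverlaidTaitGraph, Graph.deleteVerts_isLink, overlaidTaitGraph]
  constructor
  · rintro ⟨⟨rfl, rfl⟩ | ⟨rfl, rfl⟩, h, h'⟩ <;> simp_all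
  · rintro ⟨h, ⟨rfl, rfl⟩ | ⟨rfl, rfl⟩⟩ <;> simp_all

theorem balancedOverlaidTaitGraph_inc {x : H} {a : D.Crossing ⊕ D.Face} :
    (D.balancedOverlaidTaitGraph r s).Inc x a ↔ (D.face x ≠ r ∧ D.face x ≠ s) ∧
      (a = Sum.inl (D.crossing x) ∨ a = Sum.inr (D.face x)) := by
  simp [Graph.Inc, balancedOverlaidTaitGraph_isLink, exists_or]

theorem isPerfectMatching_iff_isKauffmanState :
    (D.balancedOverlaidTaitGraph r s).IsPerfectMatching M ↔ D.IsKauffmanState r s M := by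
  have hedge {x : H} : x ∈ E(D.balancedOverlaidTaitGraph r s) ↔ D.face x ≠ r ∧ D.face x ≠ s := by
    simp only [Graph.edge_mem_iff_exists_isLink, balancedOverlaidTaitGraph_isLink, exists_and_left]
    exact and_iff_left ⟨_, _, .inl ⟨rfl, rfl⟩⟩
  have hvert : V(D.balancedOverlaidTaitGraph r s) = {Sum.inr r, Sum.inr s}ᶜ := by
    simp [balancedOverlaidTaitGraph, overlaidTaitGraph, Set.compl_eq_univ_sdiff]
  have hinc (hM : ∀ x ∈ M, D.face x ≠ r ∧ D.face x ≠ s) (x : H) (a : D.Crossing ⊕ D.Face) :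
      x ∈ M ∧ (D.balancedOverlaidTaitGraph r s).Inc x a ↔
        x ∈ M ∧ (a = Sum.inl (D.crossing x) ∨ a = Sum.inr (D.face x)) :=
    and_congr_right fun hx => by rw [balancedOverlaidTaitGraph_inc, and_iff_right (hM x hx)]
  constructor
  · intro h
    have hM (x) (hx : x ∈ M) : D.face x ≠ r ∧ D.face x ≠ s := hedge.1 (h.subset hx)
    refine ⟨hM, fun c => ?_, fun f hfr hfs => ?_⟩
    · simpa [hinc hM, eq_comm] using h.existsUnique (Sum.inl c) (by simp [hvert])
    · simpa [hinc hM, eq_comm] using h.existsUnique (Sum.inr f) (by simp [hvert, hfr, hfs])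
  · intro h
    refine ⟨fun x hx => hedge.2 (h.ne x hx), fun x _ v hv => ?_, ?_⟩
    · rcases (balancedOverlaidTaitGraph_isLink.1 hv).2 with ⟨rfl, h⟩ | ⟨rfl, h⟩ <;> cases h
    · simp only [hinc h.ne, hvert]
      rintro (c | f) hv
      · simpa [eq_comm] using h.existsUnique_crossing c
      · obtain ⟨hfr, hfs⟩ : f ≠ r ∧ f ≠ s := by simpa using hv
        simpa [eq_comm] using h.existsUnique_face f hfr hfs

theorem IsKauffmanState.symm (h : D.IsKauffmanState r s M) : D.IsKauffmanState s r M :=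
  ⟨fun x hx => (h.ne x hx).symm, h.existsUnique_crossing,
    fun f hs hr => h.existsUnique_face f hr hs⟩

namespace Checkerboard

open Multigraph

/-- The crossings that are matched with a black face. -/
def matchedCrossings (C : D.Checkerboard) (M : Set H) : Set D.Crossing :=
  {c | ∃ x ∈ M, D.crossing x = c ∧ C.black (D.face x)}

theorem matchedCrossings_swap (C : D.Checkerboard) (hM : D.IsKauffmanState r s M) :
    C.swap.matchedCrossings M = (C.matchedCrossings M)ᶜ := by
  ext c
  obtain ⟨x, ⟨hx, rfl⟩, hunique⟩ := hM.existsUnique_crossing c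
  have {p : D.Face → Prop} :
      (∃ y ∈ M, D.crossing y = D.crossing x ∧ p (D.face y)) ↔ p (D.face x) :=
    ⟨fun ⟨y, hy, hyx, hp⟩ => hunique y ⟨hy, hyx⟩ ▸ hp, fun hp => ⟨x, hx, rfl, hp⟩⟩
  exact (this (p := C.swap.black)).trans (not_congr this.symm)

theorem exists_isBranching_of_isKauffmanState (C : D.Checkerboard)
    (hM : D.IsKauffmanState r s M) :
    ∃ head, IsBranching (C.subgraph (C.matchedCrossings M)) r head ∧
      ∀ x ∈ M, head (D.crossing x) = D.face x := by
  choose corner hcorner hunique using hM.existsUnique_crossing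
  have corner_crossing {x} (hx : x ∈ M) : corner (D.crossing x) = x :=
    (hunique _ x ⟨hx, rfl⟩).symm
  refine ⟨fun c => D.face (corner c), ⟨?_, ?_, ?_⟩,
    fun x hx => congrArg D.face (corner_crossing hx)⟩
  · intro c hc
    rw [edgeSet_subgraph] at hc
    obtain ⟨x, hx, rfl, hb⟩ := id hc
    rw [corner_crossing hx]
    exact (isLink_subgraph hb hc).inc_left
  · exact fun c _ => (hM.ne _ (hcorner c).1).1
  · intro c _ c' _ h
    obtain ⟨hne, hne'⟩ := hM.ne _ (hcorner c).1
    rw [← (hcorner c).2, ← (hcorner c').2]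
    exact congrArg _ ((hM.existsUnique_face _ hne hne').unique ⟨(hcorner c).1, rfl⟩
      ⟨(hcorner c').1, h.symm⟩)

theorem reachable_of_isKauffmanState (C : D.Checkerboard) (hM : D.IsKauffmanState r s M)
    (hrs : D.OnSameSquare r s) (hr : C.black r) {f : D.Face} (hf : C.black f) :
    (C.subgraph (C.matchedCrossings M)).Reachable r f := by
  set K := C.matchedCrossings M
  obtain ⟨head, hG, -⟩ := C.exists_isBranching_of_isKauffmanState hM
  obtain ⟨head', hG', -⟩ := C.swap.exists_isBranching_of_isKauffmanState hM.symm
  rw [C.matchedCrossings_swap hM] at hG'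
  have hs := C.not_black_of_onSameSquare hrs hr
  -- The faces reached from `r` and from `s` are closed under passing to the other side of an edge.
  have h : (C.subgraph K).Reachable r f ∨ (C.swap.subgraph Kᶜ).Reachable s f := by
    refine forall_face_of_flip (Z := fun g => (C.subgraph K).Reachable r g ∨
      (C.swap.subgraph Kᶜ).Reachable s g) ?_ (.inl .refl) f
    rintro x (hx | hx)
    · exact .inr (reachable_face_flip hG hrs hr hx)
    · have h := reachable_face_flip hG' hrs.symm hs hx
      rw [compl_compl, swap_swap] at h
      exact .inl h
  exact h.resolve_right fun h => black_of_reachable (C := C.swap) hs h hf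

theorem reachable_deleteEdges_of_isKauffmanState (C : D.Checkerboard)
    (hM : D.IsKauffmanState r s M) (hrs : D.OnSameSquare r s) (hr : C.black r) {x : H}
    (hx : x ∈ M) (hb : C.black (D.face x)) :
    ((C.subgraph (C.matchedCrossings M)).deleteEdges {D.crossing x}).Reachable r
      (D.face (D.rot (D.rot x))) := by
  obtain ⟨head, hG, hhead⟩ := C.exists_isBranching_of_isKauffmanState hM
  have hc : D.crossing x ∈ C.matchedCrossings M := ⟨x, hx, rfl, hb⟩
  apply hG.reachable_tail <;> rw [hhead x hx]
  · exact C.reachable_of_isKauffmanState hM hrs hr hb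
  · exact (isLink_subgraph hb hc).symm

theorem isTree_of_isKauffmanState (C : D.Checkerboard) (hM : D.IsKauffmanState r s M)
    (hrs : D.OnSameSquare r s) (hr : C.black r) :
    (C.subgraph (C.matchedCrossings M)).IsTree := by
  obtain ⟨head, hG, -⟩ := C.exists_isBranching_of_isKauffmanState hM
  exact hG.isTree hr fun f hf => C.reachable_of_isKauffmanState hM hrs hr hf

theorem mem_of_matchedCrossings_eq (C : D.Checkerboard) (hM : D.IsKauffmanState r s M)
    (hM' : D.IsKauffmanState r s M') (hrs : D.OnSameSquare r s) (hr : C.black r)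
    (hK : C.matchedCrossings M = C.matchedCrossings M') {x : H} (hx : x ∈ M)
    (hb : C.black (D.face x)) : x ∈ M' := by
  obtain ⟨x', hx', hxx', hb'⟩ : D.crossing x ∈ C.matchedCrossings M' := hK ▸ ⟨x, hx, rfl, hb⟩
  rcases C.eq_of_crossing_eq hxx'.symm hb hb' with rfl | rfl
  · exact hx'
  -- Otherwise both ends of the edge `crossing x` of the tree are reached without this edge.
  have h := C.reachable_deleteEdges_of_isKauffmanState hM hrs hr hx hb
  have h' := C.reachable_deleteEdges_of_isKauffmanState hM' hrs hr hx' hb'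
  rw [← hK, crossing_rot_rot, D.rot_four] at h'
  exact absurd ((reachable_symm h').trans h) (not_reachable_deleteEdges
    (C.isTree_of_isKauffmanState hM hrs hr).acyclic (isLink_subgraph hb ⟨x, hx, rfl, hb⟩))

theorem subset_of_matchedCrossings_eq (C : D.Checkerboard) (hM : D.IsKauffmanState r s M)
    (hM' : D.IsKauffmanState r s M') (hrs : D.OnSameSquare r s) (hr : C.black r)
    (hK : C.matchedCrossings M = C.matchedCrossings M') : M ⊆ M' := by
  intro x hx
  by_cases hb : C.black (D.face x)
  · exact C.mem_of_matchedCrossings_eq hM hM' hrs hr hK hx hb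
  · refine C.swap.mem_of_matchedCrossings_eq hM.symm hM'.symm hrs.symm
      (C.not_black_of_onSameSquare hrs hr) ?_ hx hb
    rw [C.matchedCrossings_swap hM, C.matchedCrossings_swap hM', hK]

theorem eq_of_matchedCrossings_eq (C : D.Checkerboard) (hM : D.IsKauffmanState r s M)
    (hM' : D.IsKauffmanState r s M') (hrs : D.OnSameSquare r s) (hr : C.black r)
    (hK : C.matchedCrossings M = C.matchedCrossings M') : M = M' :=
  (C.subset_of_matchedCrossings_eq hM hM' hrs hr hK).antisymm
    (C.subset_of_matchedCrossings_eq hM' hM hrs hr hK.symm)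

section Branching

variable {K : Set D.Crossing} {head : D.Crossing → D.Face} {f : D.Face} {C : D.Checkerboard}

theorem existsUnique_headCorners_crossing (hG : IsBranching (C.subgraph K) r head)
    (hr : ∀ f, C.black f → (C.subgraph K).Reachable r f) {c : D.Crossing} (hc : c ∈ K) :
    ∃! x, x ∈ C.headCorners K head ∧ D.crossing x = c := by
  obtain ⟨x, rfl, hb⟩ := C.exists_black_corner c
  obtain ⟨y, hy, hyx⟩ : ∃ y, y ∈ C.headCorners K head ∧ D.crossing y = D.crossing x := by
    rcases hG.eq_or_eq (isLink_subgraph hb hc) with h | h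
    · exact ⟨x, ⟨hb, hc, h⟩, rfl⟩
    · have hx : D.crossing (D.rot (D.rot x)) = D.crossing x := crossing_rot_rot x
      exact ⟨D.rot (D.rot x), ⟨(C.black_rot_rot x).2 hb, hx ▸ hc, hx ▸ h⟩, hx⟩
  exact ⟨y, ⟨hy, hyx⟩, fun z ⟨hz, hzx⟩ =>
    eq_of_mem_headCorners hG (hr _ hz.1) hz hy (hzx.trans hyx.symm)⟩

theorem existsUnique_headCorners_face (hG : IsBranching (C.subgraph K) r head)
    (hr : ∀ f, C.black f → (C.subgraph K).Reachable r f) (hf : C.black f) (hfr : f ≠ r) :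
    ∃! x, x ∈ C.headCorners K head ∧ D.face x = f := by
  obtain ⟨c, hc, rfl⟩ := (hG.bijOn hr).surjOn ⟨hf, hfr⟩
  rw [edgeSet_subgraph] at hc
  obtain ⟨x, hx, rfl⟩ := (existsUnique_headCorners_crossing hG hr hc).exists
  exact ⟨x, ⟨hx, hx.2.2.symm⟩, fun z ⟨hz, hzx⟩ =>
    eq_of_mem_headCorners_of_face_eq hG (hr _ hz.1) hz hx (hzx.trans hx.2.2)⟩

theorem isKauffmanState_headCorners_union {head' : D.Crossing → D.Face}
    (hG : IsBranching (C.subgraph K) r head)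
    (hr : ∀ f, C.black f → (C.subgraph K).Reachable r f)
    (hG' : IsBranching (C.swap.subgraph Kᶜ) s head')
    (hs : ∀ f, ¬ C.black f → (C.swap.subgraph Kᶜ).Reachable s f)
    (hrb : C.black r) (hsb : ¬ C.black s) :
    D.IsKauffmanState r s (C.headCorners K head ∪ C.swap.headCorners Kᶜ head') where
  ne x hx := by
    rcases hx with ⟨hb, hK, h⟩ | ⟨hb, hK, h⟩
    · exact ⟨h ▸ hG.ne_root _ (by simpa using hK), fun hxs => hsb (hxs ▸ hb)⟩
    · exact ⟨fun hxr => hb (hxr ▸ hrb), h ▸ hG'.ne_root _ (by simpa using hK)⟩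
  existsUnique_crossing c := by
    by_cases hc : c ∈ K
    · refine (existsUnique_congr fun x => and_congr_left fun hxc => ?_).1
        (existsUnique_headCorners_crossing hG hr hc)
      exact (or_iff_left fun h => h.2.1 (hxc ▸ hc)).symm
    · refine (existsUnique_congr fun x => and_congr_left fun hxc => ?_).1
        (existsUnique_headCorners_crossing hG' hs hc)
      exact (or_iff_right fun h => hc (hxc ▸ h.2.1)).symm
  existsUnique_face f hfr hfs := by
    by_cases hf : C.black f
    · refine (existsUnique_congr fun x => and_congr_left fun hxf => ?_).1
        (existsUnique_headCorners_face hG hr hf hfr)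
      exact (or_iff_left fun h => h.1 (hxf ▸ hf)).symm
    · refine (existsUnique_congr fun x => and_congr_left fun hxf => ?_).1
        (existsUnique_headCorners_face hG' hs hf hfs)
      exact (or_iff_right fun h => hf (hxf ▸ h.1)).symm

theorem matchedCrossings_headCorners_union {head' : D.Crossing → D.Face}
    (hG : IsBranching (C.subgraph K) r head)
    (hr : ∀ f, C.black f → (C.subgraph K).Reachable r f) :
    C.matchedCrossings (C.headCorners K head ∪ C.swap.headCorners Kᶜ head') = K := by
  ext c
  constructor
  · rintro ⟨x, hx | hx, rfl, hb⟩
    exacts [hx.2.1, absurd hb hx.1]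
  · intro hc
    obtain ⟨x, hx, rfl⟩ := (existsUnique_headCorners_crossing hG hr hc).exists
    exact ⟨x, .inl hx, rfl, hx.1⟩

theorem reachable_swap_subgraph_compl (hG : IsBranching (C.subgraph K) r head)
    (hrs : D.OnSameSquare r s) (hrb : C.black r)
    (hr : ∀ f, C.black f → (C.subgraph K).Reachable r f) (hf : ¬ C.black f) :
    (C.swap.subgraph Kᶜ).Reachable s f := by
  obtain ⟨x, rfl⟩ : ∃ x, D.face x = f := Quotient.exists_rep f
  rw [← D.flip_flip x]
  exact reachable_face_flip hG hrs hrb (hr _ ((C.alternate x).2 hf))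

theorem ncard_compl_add_one (hG : IsBranching (C.subgraph K) r head) (hrb : C.black r)
    (hr : ∀ f, C.black f → (C.subgraph K).Reachable r f) :
    Kᶜ.ncard + 1 = {f | ¬ C.black f}.ncard := by
  have := D.finite_face
  have := D.finite_crossing
  have hblack : K.ncard + 1 = {f | C.black f}.ncard := by
    simpa using! hG.ncard_edgeSet_add_one hrb hr
  have hcrossing := Set.ncard_add_ncard_compl K
  have hface := Set.ncard_add_ncard_compl {f | C.black f}
  have heuler := D.card_face
  rw [Set.compl_ofPred] at hface
  lia

end Branching

theorem exists_isKauffmanState (C : D.Checkerboard) {K : Set D.Crossing}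
    (hK : (C.subgraph K).IsTree) (hrs : D.OnSameSquare r s) (hr : C.black r) :
    ∃ M, D.IsKauffmanState r s M ∧ C.matchedCrossings M = K := by
  have := D.finite_crossing
  have hs := C.not_black_of_onSameSquare hrs hr
  have hconn : ∀ f, C.black f → (C.subgraph K).Reachable r f := hK.connected r hr
  obtain ⟨head, hG⟩ := exists_isBranching_of_isTree hK hr
  have hconn' : ∀ f, ¬ C.black f → (C.swap.subgraph Kᶜ).Reachable s f :=
    fun f => reachable_swap_subgraph_compl hG hrs hr hconn
  obtain ⟨head', hG'⟩ : ∃ head', IsBranching (C.swap.subgraph Kᶜ) s head' :=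
    exists_isBranching_of_ncard_edgeSet hs hconn'
      (by simpa using! ncard_compl_add_one hG hr hconn)
  exact ⟨_, isKauffmanState_headCorners_union hG hconn hG' hconn' hr hs,
    matchedCrossings_headCorners_union hG hconn⟩

/-- The rooted spanning tree of a Kauffman state, with the crossings matched with a black face as
edges. -/
def stateTree (C : D.Checkerboard) (hM : D.IsKauffmanState r s M) (hrs : D.OnSameSquare r s)
    (hr : C.black r) : C.taitGraph.RootedSpanningTree where
  tree := C.subgraph (C.matchedCrossings M)
  root := r
  spanning := ⟨Graph.restrict_le, rfl⟩
  isTree := C.isTree_of_isKauffmanState hM hrs hr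
  root_mem := hr

theorem exists_stateTree_eq (C : D.Checkerboard) (hrs : D.OnSameSquare r s) (hr : C.black r)
    (T : C.taitGraph.RootedSpanningTree) (hT : T.root = r) :
    ∃ (M : Set H) (hM : D.IsKauffmanState r s M), C.stateTree hM hrs hr = T := by
  have hsub : T.tree = C.subgraph E(T.tree) := eq_restrict_edgeSet T.spanning
  obtain ⟨M, hM, hK⟩ := C.exists_isKauffmanState (hsub ▸ T.isTree) hrs hr
  exact ⟨M, hM, rootedSpanningTree_ext (edgeSet_subgraph.trans hK) hT.symm⟩

end Checkerboard

end KnotDiagram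

theorem proposition3p5 {H : Type*} (D : KnotDiagram H) (C : D.Checkerboard)
    (r s : D.Face) (hr : C.black r) (hrs : D.OnSameSquare r s) :
    ∃ Φ : {M : Set H // (D.balancedOverlaidTaitGraph r s).IsPerfectMatching M} ≃
        {T : C.taitGraph.RootedSpanningTree // T.root = r},
      ∀ M,
        (∀ c : D.Crossing, c ∈ (Φ M).1.tree.edgeSet ↔
          ∃ x ∈ M.1, D.crossing x = c ∧ C.black (D.face x)) ∧
        (∀ x ∈ M.1, C.black (D.face x) →
          ((Φ M).1.tree.deleteEdges {D.crossing x}).Reachable r (D.face (D.rot (D.rot x)))) := by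
  have hstate (M : {M : Set H // (D.balancedOverlaidTaitGraph r s).IsPerfectMatching M}) :
      D.IsKauffmanState r s M.1 := KnotDiagram.isPerfectMatching_iff_isKauffmanState.1 M.2
  let φ (M : {M : Set H // (D.balancedOverlaidTaitGraph r s).IsPerfectMatching M}) :
      {T : C.taitGraph.RootedSpanningTree // T.root = r} := ⟨C.stateTree (hstate M) hrs hr, rfl⟩
  have edgeSet_φ (M) : E((φ M).1.tree) = C.matchedCrossings M.1 :=
    KnotDiagram.Checkerboard.edgeSet_subgraph
  have φ_injective : φ.Injective := fun M M' h => Subtype.ext <|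
    C.eq_of_matchedCrossings_eq (hstate M) (hstate M') hrs hr (by rw [← edgeSet_φ, h, edgeSet_φ])
  have φ_surjective : φ.Surjective := by
    rintro ⟨T, hT⟩
    obtain ⟨M, hM, rfl⟩ := C.exists_stateTree_eq hrs hr T hT
    exact ⟨⟨M, KnotDiagram.isPerfectMatching_iff_isKauffmanState.2 hM⟩, rfl⟩
  refine ⟨.ofBijective φ ⟨φ_injective, φ_surjective⟩, fun M => ⟨fun c => ?_, fun x hx hb => ?_⟩⟩
  · exact Set.ext_iff.1 (edgeSet_φ M) c
  · exact C.reachable_deleteEdges_of_isKauffmanState (hstate M) hrs hr hx hb
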